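/- Let $N\ge 1$, let $\Omega\subseteq\mathbb R^N$ be an open set (bounded or not, possibly all of $\mathbb R^N$), and let $T>0$, $q>1$ and $\alpha>-1$. Let $u$ be a real-valued (not necessarily nonnegative) classical solution of $$\partial_t u-\Delta u+t^{\alpha}|u|^{q-1}u=0\quad\text{in }\Omega\times(0,T),$$ that is, $u\in C^{2,1}(\Omega\times(0,T))$ ($u$, $\partial_t u$, $D_xu$ and $D_x^2u$ are continuous in $\Omega\times(0,T)$) and the equation holds at every point. Assume that $u$ is continuous on $\overline\Omega\times(0,T)$ and vanishes on the lateral boundary $\partial\Omega\times(0,T)$; no condition is imposed on $u$ at $t=0$, where it may be singular. Then $$u(x,t)\le c_\alpha\, t^{-\frac{1+\alpha}{q-1}}\quad\text{for all }(x,t)\in\Omega\times(0,T),\qquad c_\alpha=\Big(\frac{1+\alpha}{q-1}\Big)^{\frac1{q-1}}.$$ -/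

import Mathlib

/-- `u ∈ C^{2,1}(Ω × (0,T))`: the function `u`, its time derivative and its space derivatives of
order one and two exist and are jointly continuous in `Ω × (0,T)`. -/
structure IsC21 {N : ℕ} (Ω : Set (EuclideanSpace ℝ (Fin N))) (T : ℝ)
    (u : EuclideanSpace ℝ (Fin N) → ℝ → ℝ) : Prop where
  /-- each time slice is twice continuously differentiable in space -/
  contDiffOn_space : ∀ t ∈ Set.Ioo 0 T, ContDiffOn ℝ 2 (fun y => u y t) Ω
  /-- the time derivative exists -/
  differentiableAt_time : ∀ x ∈ Ω, ∀ t ∈ Set.Ioo 0 T, DifferentiableAt ℝ (fun s => u x s) t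
  /-- `u`, `D_x u` and `D_x^2 u` (`k = 0, 1, 2`) are jointly continuous -/
  continuousOn_space : ∀ k : ℕ, k ≤ 2 → ContinuousOn
    (fun p : EuclideanSpace ℝ (Fin N) × ℝ => iteratedFDeriv ℝ k (fun y => u y p.2) p.1)
    (Ω ×ˢ Set.Ioo 0 T)
  /-- `∂_t u` is jointly continuous -/
  continuousOn_time : ContinuousOn
    (fun p : EuclideanSpace ℝ (Fin N) × ℝ => deriv (fun s => u p.1 s) p.2)
    (Ω ×ˢ Set.Ioo 0 T)

/-- `u` is a (classical) solution of `∂_t u - Δ u + t^α |u|^{q-1} u = 0` in `Ω × (0,T)`. -/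
structure IsSolution {N : ℕ} (Ω : Set (EuclideanSpace ℝ (Fin N))) (T α q : ℝ)
    (u : EuclideanSpace ℝ (Fin N) → ℝ → ℝ) : Prop where
  /-- `u` is of class `C^{2,1}` -/
  isC21 : IsC21 Ω T u
  /-- the equation holds at every point -/
  equation : ∀ x ∈ Ω, ∀ t ∈ Set.Ioo 0 T,
    deriv (fun s => u x s) t - Laplacian.laplacian (fun y => u y t) x
      + t ^ α * |u x t| ^ (q - 1) * u x t = 0

/-- `u` is continuous up to the lateral boundary `∂Ω × (0,T)` and vanishes there. Nothing is asked
of `u` at `t = 0`, where it may be singular. -/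
structure VanishesOnLateralBoundary {N : ℕ} (Ω : Set (EuclideanSpace ℝ (Fin N))) (T : ℝ)
    (u : EuclideanSpace ℝ (Fin N) → ℝ → ℝ) : Prop where
  /-- `u` is continuous on the closure of `Ω` times `(0,T)` -/
  continuousOn : ContinuousOn (fun p : EuclideanSpace ℝ (Fin N) × ℝ => u p.1 p.2)
    (closure Ω ×ˢ Set.Ioo 0 T)
  /-- `u = 0` on the lateral boundary -/
  eq_zero : ∀ x ∈ frontier Ω, ∀ t ∈ Set.Ioo 0 T, u x t = 0

/-!
Fix `x₀ ∈ Ω` and `0 < τ < t`. Let `y` be the solution of `y' = -s^α y^q` that blows up at `s = τ`,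
and let `w` be a Keller–Osserman supersolution of `-Δw + c w^q = 0`, `c = min_{[τ, t]} s^α`, that
blows up on the boundary of the ball `B(x₀, R)`. Since `r ↦ r^q` is superadditive, `y + w` is a
supersolution of the parabolic equation; it dominates `u` near `s = τ` and near `∂B(x₀, R)` because
it is infinite there, whatever the size of `u`, and it dominates `u` on `∂Ω` because it is
nonnegative. The maximum principle gives `u ≤ y + w` in `Ω ∩ B(x₀, R)`. Now let `R → ∞`, which sends
`w(x₀)` to `0`, and then `τ → 0`, which turns `y(t)` into the claimed bound.
-/

open Set Filter Topology Metric
open scoped Laplacian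

theorem iteratedDeriv_two_nonpos_of_isLocalMax {f : ℝ → ℝ} {a : ℝ} (h : IsLocalMax f a)
    (hf : ContinuousAt f a) : iteratedDeriv 2 f a ≤ 0 := by
  rw [iteratedDeriv_succ, iteratedDeriv_one]
  by_contra! hpos
  have hmin : IsLocalMin f a := isLocalMin_of_deriv_deriv_pos hpos h.deriv_eq_zero hf
  have hconst : f =ᶠ[𝓝 a] fun _ => f a := by
    filter_upwards [h, hmin] with s h₁ h₂ using le_antisymm h₁ h₂
  simp [hconst.deriv.deriv_eq] at hpos

theorem nonneg_of_isLocalMaxOn_Iic {f : ℝ → ℝ} {f' t : ℝ} (h : IsLocalMaxOn f (Iic t) t)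
    (hf : HasDerivAt f f' t) : 0 ≤ f' := by
  have hcone : (-1 : ℝ) ∈ posTangentConeAt (Iic t) t :=
    mem_posTangentConeAt_of_segment_subset <|
      (convex_Iic t).segment_subset self_mem_Iic (by simp)
  simpa using h.hasFDerivWithinAt_nonpos hf.hasFDerivAt.hasFDerivWithinAt hcone

theorem iteratedDeriv_two_comp_norm_add_smul_sq {E : Type*} [NormedAddCommGroup E]
    [InnerProductSpace ℝ E] {φ : ℝ → ℝ} {z e : E} (he : ‖e‖ = 1)
    (hφ : ContDiffAt ℝ 2 φ (‖z‖ ^ 2)) :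
    iteratedDeriv 2 (fun s : ℝ => φ (‖z + s • e‖ ^ 2)) 0 =
      4 * iteratedDeriv 2 φ (‖z‖ ^ 2) * inner ℝ z e ^ 2 + 2 * deriv φ (‖z‖ ^ 2) := by
  set f : ℝ → ℝ := fun s => ‖z‖ ^ 2 + 2 * inner ℝ z e * s + s ^ 2
  have hf : (fun s : ℝ => φ (‖z + s • e‖ ^ 2)) = φ ∘ f := by
    ext s
    rw [norm_add_sq_real, norm_smul, he, inner_smul_right]
    simp only [Function.comp_apply, f, Real.norm_eq_abs, mul_one, sq_abs]
    ring_nf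
  have hf₀ : f 0 = ‖z‖ ^ 2 := by simp [f]
  have hf' : deriv f = fun s => 2 * inner ℝ z e + 2 * s := by
    ext s
    simpa using ((((hasDerivAt_id s).const_mul (2 * inner ℝ z e)).const_add
      (‖z‖ ^ 2)).fun_add (hasDerivAt_pow 2 s)).deriv
  have hf'' : iteratedDeriv 2 f 0 = 2 := by
    simp [iteratedDeriv_succ, hf']
  rw [hf, iteratedDeriv_comp_two (by rwa [hf₀]) (by fun_prop), hf'', hf', hf₀]
  ring

theorem contDiffAt_rpow_sub_norm_sq {E : Type*} [NormedAddCommGroup E] [InnerProductSpace ℝ E]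
    {x₀ x : E} {a : ℝ} (hx : ‖x - x₀‖ ^ 2 < a) (p : ℝ) :
    ContDiffAt ℝ 2 (fun y => (a - ‖y - x₀‖ ^ 2) ^ p) x :=
  (contDiffAt_const.sub ((contDiffAt_id.sub contDiffAt_const).norm_sq ℝ)).rpow_const_of_ne
    (sub_pos.2 hx).ne'

section Laplacian

variable {E : Type*} [NormedAddCommGroup E] [InnerProductSpace ℝ E] [FiniteDimensional ℝ E]

theorem laplacian_eq_sum_iteratedDeriv {ι F : Type*} [Fintype ι] [NormedAddCommGroup F]
    [NormedSpace ℝ F] (v : OrthonormalBasis ι ℝ E) {g : E → F} {x : E} (hg : ContDiffAt ℝ 2 g x) :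
    Δ g x = ∑ i, iteratedDeriv 2 (fun s : ℝ => g (x + s • v i)) 0 := by
  rw [InnerProductSpace.laplacian_eq_iteratedFDeriv_orthonormalBasis g v]
  refine Finset.sum_congr rfl fun i _ => ?_
  set line : ℝ → E := fun s => x + s • v i
  have hline : deriv line = fun _ => v i := by
    ext1 s
    exact (((hasDerivAt_id s).smul_const (v i)).const_add x).deriv.trans (one_smul ℝ (v i))
  have hline₂ : iteratedDeriv 2 line 0 = 0 := by
    rw [iteratedDeriv_succ, iteratedDeriv_one, hline, deriv_const]
  have hx : line 0 = x := by simp [line]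
  have hcomp : iteratedDeriv 2 (g ∘ line) 0 = iteratedFDeriv ℝ 2 g x (fun _ => v i) := by
    rw [iteratedDeriv_vcomp_two (by rwa [hx]) (by fun_prop), hline₂, hline, hx, map_zero, add_zero]
  convert! hcomp.symm using 2
  ext j
  fin_cases j <;> rfl

theorem laplacian_nonpos_of_isLocalMax {g : E → ℝ} {x : E} (h : IsLocalMax g x)
    (hg : ContDiffAt ℝ 2 g x) : Δ g x ≤ 0 := by
  rw [laplacian_eq_sum_iteratedDeriv (stdOrthonormalBasis ℝ E) hg]
  refine Finset.sum_nonpos fun i _ => ?_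
  set line : ℝ → E := fun s => x + s • stdOrthonormalBasis ℝ E i
  have hline : ContinuousAt line 0 := by fun_prop
  have hx : line 0 = x := by simp [line]
  rw [← hx] at h hg
  exact iteratedDeriv_two_nonpos_of_isLocalMax (h.comp_continuous hline)
    (hg.continuousAt.comp hline)

theorem laplacian_comp_norm_sub_sq {φ : ℝ → ℝ} {x₀ x : E}
    (hφ : ContDiffAt ℝ 2 φ (‖x - x₀‖ ^ 2)) :
    Δ (fun y => φ (‖y - x₀‖ ^ 2)) x =
      4 * iteratedDeriv 2 φ (‖x - x₀‖ ^ 2) * ‖x - x₀‖ ^ 2 +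
        2 * Module.finrank ℝ E * deriv φ (‖x - x₀‖ ^ 2) := by
  have hsmooth : ContDiffAt ℝ 2 (fun y => φ (‖y - x₀‖ ^ 2)) x :=
    ContDiffAt.comp x hφ ((contDiffAt_id.sub contDiffAt_const).norm_sq ℝ)
  set v := stdOrthonormalBasis ℝ E
  simp only [laplacian_eq_sum_iteratedDeriv v hsmooth, add_sub_right_comm x,
    iteratedDeriv_two_comp_norm_add_smul_sq (v.norm_eq_one _) hφ, Finset.sum_add_distrib,
    ← Finset.mul_sum, v.sum_sq_inner_left, Finset.sum_const, Finset.card_univ, Fintype.card_fin,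
    nsmul_eq_mul]
  ring

theorem laplacian_rpow_sub_norm_sq {x₀ x : E} {a : ℝ} (hx : ‖x - x₀‖ ^ 2 < a) (p : ℝ) :
    Δ (fun y => (a - ‖y - x₀‖ ^ 2) ^ p) x =
      4 * p * (p - 1) * (a - ‖x - x₀‖ ^ 2) ^ (p - 2) * ‖x - x₀‖ ^ 2 -
        2 * Module.finrank ℝ E * p * (a - ‖x - x₀‖ ^ 2) ^ (p - 1) := by
  have hsmooth : ContDiffAt ℝ 2 (fun r => (a - r) ^ p) (‖x - x₀‖ ^ 2) :=
    ContDiffAt.rpow_const_of_ne (by fun_prop) (sub_pos.2 hx).ne'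
  have hderiv₂ : iteratedDeriv 2 (fun r => (a - r) ^ p) (‖x - x₀‖ ^ 2) =
      p * (p - 1) * (a - ‖x - x₀‖ ^ 2) ^ (p - 2) := by
    rw [iteratedDeriv_comp_const_sub (f := fun r => r ^ p)]
    simp [iteratedDeriv_eq_iterate, Real.iter_deriv_rpow_const, descPochhammer_succ_right]
  rw [laplacian_comp_norm_sub_sq (φ := fun r => (a - r) ^ p) hsmooth, hderiv₂,
    deriv_comp_const_sub (f := fun r => r ^ p), Real.deriv_rpow_const]
  ring

end Laplacian

section Comparison

variable {E : Type*} [NormedAddCommGroup E] [InnerProductSpace ℝ E] [FiniteDimensional ℝ E]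

theorem nonpos_of_deriv_lt_laplacian {G : Set E} (hG : IsOpen G) (hGb : Bornology.IsBounded G)
    {σ θ : ℝ} {v : E → ℝ → ℝ}
    (hv : ContinuousOn (fun p : E × ℝ => v p.1 p.2) (closure G ×ˢ Icc σ θ))
    (hinit : ∀ x ∈ closure G, v x σ ≤ 0)
    (hlat : ∀ x ∈ frontier G, ∀ s ∈ Icc σ θ, v x s ≤ 0)
    (hspace : ∀ x ∈ G, ∀ s ∈ Ioc σ θ, ContDiffAt ℝ 2 (fun y => v y s) x)
    (htime : ∀ x ∈ G, ∀ s ∈ Ioc σ θ, DifferentiableAt ℝ (v x) s)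
    (hlt : ∀ x ∈ G, ∀ s ∈ Ioc σ θ, 0 < v x s → deriv (v x) s < Δ (fun y => v y s) x)
    {x : E} (hx : x ∈ closure G) {t : ℝ} (ht : t ∈ Icc σ θ) : v x t ≤ 0 := by
  by_contra! hpos
  obtain ⟨⟨z, s⟩, ⟨hz, hs⟩, hmax⟩ :=
    (hGb.isCompact_closure.prod isCompact_Icc).exists_isMaxOn ⟨(x, t), hx, ht⟩ hv
  have hle : ∀ z' ∈ closure G, ∀ s' ∈ Icc σ θ, v z' s' ≤ v z s :=
    fun z' hz' s' hs' => hmax (mk_mem_prod hz' hs')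
  have hzs : 0 < v z s := hpos.trans_le (hle x hx t ht)
  have hzG : z ∈ G := by
    by_contra hzG
    exact (hlat z ⟨hz, by rwa [hG.interior_eq]⟩ s hs).not_gt hzs
  have hσs : σ < s := hs.1.lt_of_ne fun h => (h ▸ hinit z hz).not_gt hzs
  have hΔ : Δ (fun y => v y s) z ≤ 0 := by
    refine laplacian_nonpos_of_isLocalMax ?_ (hspace z hzG s ⟨hσs, hs.2⟩)
    filter_upwards [hG.mem_nhds hzG] with y hy using hle y (subset_closure hy) s hs
  have hderiv : 0 ≤ deriv (v z) s := by
    refine nonneg_of_isLocalMaxOn_Iic ?_ (htime z hzG s ⟨hσs, hs.2⟩).hasDerivAt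
    filter_upwards [inter_mem_nhdsWithin (Iic s) (Ioi_mem_nhds hσs)] with r hr
      using hle z hz r ⟨le_of_lt hr.2, hr.1.trans hs.2⟩
  exact (hlt z hzG s ⟨hσs, hs.2⟩ hzs).not_ge (hΔ.trans hderiv)

/-- Classical subsolutions of `∂ₜu - Δu + h(t) |u|^{q-1} u = 0` in `Ω × I` that are nonpositive on
the lateral boundary `∂Ω × I`. The differential inequality is only required where `u` is positive,
so that `|u|^{q-1} u = u^q`. -/
structure IsDirichletSubsolution (Ω : Set E) (I : Set ℝ) (h : ℝ → ℝ) (q : ℝ) (u : E → ℝ → ℝ) :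
    Prop where
  contDiffOn_space : ∀ t ∈ I, ContDiffOn ℝ 2 (fun y => u y t) Ω
  differentiableAt_time : ∀ x ∈ Ω, ∀ t ∈ I, DifferentiableAt ℝ (u x) t
  deriv_add_le_laplacian : ∀ x ∈ Ω, ∀ t ∈ I, 0 < u x t →
    deriv (u x) t + h t * u x t ^ q ≤ Δ (fun y => u y t) x
  continuousOn : ContinuousOn (fun p : E × ℝ => u p.1 p.2) (closure Ω ×ˢ I)
  nonpos_of_mem_frontier : ∀ x ∈ frontier Ω, ∀ t ∈ I, u x t ≤ 0

/-- Nonnegative supersolutions of the elliptic equation `-Δw + c w^q = 0` in the ball of centre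
`x₀` and radius `R` that are large, that is, blow up on the boundary sphere. -/
structure IsLargeSupersolution (x₀ : E) (R c q : ℝ) (w : E → ℝ) : Prop where
  nonneg : ∀ x ∈ ball x₀ R, 0 ≤ w x
  contDiffAt : ∀ x ∈ ball x₀ R, ContDiffAt ℝ 2 w x
  laplacian_le : ∀ x ∈ ball x₀ R, Δ w x ≤ c * w x ^ q
  tendsto_atTop : Tendsto w (comap (fun x => dist x x₀) (𝓝[<] R)) atTop

variable {Ω : Set E} {I : Set ℝ} {h : ℝ → ℝ} {q : ℝ} {u : E → ℝ → ℝ}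

theorem IsDirichletSubsolution.deriv_sub_lt_laplacian_sub
    (hu : IsDirichletSubsolution Ω I h q u) (hΩ : IsOpen Ω) (hq : 1 ≤ q) {x : E} (hx : x ∈ Ω)
    {s : ℝ} (hs : s ∈ I) (hpos : 0 < h s) {y : ℝ → ℝ} (hy₀ : 0 ≤ y s)
    (hy : HasDerivAt y (-(h s * y s ^ q)) s) {w : E → ℝ} (hw₀ : 0 ≤ w x)
    (hw : ContDiffAt ℝ 2 w x) (hΔw : Δ w x ≤ h s * w x ^ q) (hlt : y s + w x < u x s) :
    deriv (fun r => u x r - (y r + w x)) s < Δ (fun z => u z s - (y s + w z)) x := by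
  have hux : ContDiffAt ℝ 2 (fun z => u z s) x :=
    (hu.contDiffOn_space s hs).contDiffAt (hΩ.mem_nhds hx)
  have hderiv : deriv (fun r => u x r - (y r + w x)) s = deriv (u x) s + h s * y s ^ q := by
    rw [((hu.differentiableAt_time x hx s hs).hasDerivAt.fun_sub (hy.add_const _)).deriv,
      sub_neg_eq_add]
  have hΔ : Δ (fun z => u z s - (y s + w z)) x = Δ (fun z => u z s) x - Δ w x := by
    have hyw : ContDiffAt ℝ 2 ((fun _ : E => y s) + w) x := contDiffAt_const.add hw
    have hΔyw : Δ ((fun _ : E => y s) + w) x = Δ w x := by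
      rw [contDiffAt_const.laplacian_add hw]
      simp
    exact (hux.laplacian_sub hyw).trans (by rw [hΔyw])
  have hpow : y s ^ q + w x ^ q < u x s ^ q :=
    (Real.add_rpow_le_rpow_add hy₀ hw₀ hq).trans_lt
      (Real.rpow_lt_rpow (add_nonneg hy₀ hw₀) hlt (zero_lt_one.trans_le hq))
  have hsub := hu.deriv_add_le_laplacian x hx s hs ((add_nonneg hy₀ hw₀).trans_lt hlt)
  have habs := mul_lt_mul_of_pos_left hpow hpos
  linarith

theorem IsDirichletSubsolution.le_add_of_le_on_boundary (hu : IsDirichletSubsolution Ω I h q u)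
    (hΩ : IsOpen Ω) (hq : 1 ≤ q) {G : Set E} (hG : IsOpen G) (hGb : Bornology.IsBounded G)
    {σ t : ℝ} (hσt : σ ≤ t) (hI : Icc σ t ⊆ I) (hpos : ∀ s ∈ Icc σ t, 0 < h s)
    {y : ℝ → ℝ} (hy₀ : ∀ s ∈ Icc σ t, 0 ≤ y s)
    (hy : ∀ s ∈ Icc σ t, HasDerivAt y (-(h s * y s ^ q)) s)
    {w : E → ℝ} (hw₀ : ∀ z ∈ closure G, 0 ≤ w z) (hw : ∀ z ∈ closure G, ContDiffAt ℝ 2 w z)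
    (hΔw : ∀ z ∈ G, ∀ s ∈ Icc σ t, Δ w z ≤ h s * w z ^ q)
    (hinit : ∀ z ∈ closure Ω ∩ closure G, u z σ ≤ y σ + w z)
    (hlat : ∀ z ∈ closure Ω ∩ frontier G, ∀ s ∈ Icc σ t, u z s ≤ y s + w z)
    {x : E} (hx : x ∈ Ω ∩ G) : u x t ≤ y t + w x := by
  have hclosure : closure (Ω ∩ G) ⊆ closure Ω ∩ closure G :=
    closure_inter_subset_inter_closure Ω G
  rw [← sub_nonpos]
  refine nonpos_of_deriv_lt_laplacian (v := fun z s => u z s - (y s + w z)) (hΩ.inter hG)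
    (hGb.subset inter_subset_right) ?_ (fun z hz => sub_nonpos.2 (hinit z (hclosure hz))) ?_ ?_ ?_
    ?_ (subset_closure hx) (right_mem_Icc.2 hσt)
  · have hyc : ContinuousOn y (Icc σ t) := fun s hs => (hy s hs).continuousAt.continuousWithinAt
    have hwc : ContinuousOn w (closure G) := fun z hz => (hw z hz).continuousAt.continuousWithinAt
    exact (hu.continuousOn.mono (prod_mono (hclosure.trans inter_subset_left) hI)).sub
      ((hyc.comp continuousOn_snd fun p hp => hp.2).add
        (hwc.comp continuousOn_fst fun p hp => (hclosure hp.1).2))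
  · intro z hz s hs
    rcases frontier_inter_subset Ω G hz with ⟨hzΩ, hzG⟩ | hz'
    · exact sub_nonpos.2 ((hu.nonpos_of_mem_frontier z hzΩ s (hI hs)).trans
        (add_nonneg (hy₀ s hs) (hw₀ z hzG)))
    · exact sub_nonpos.2 (hlat z hz' s hs)
  · exact fun z hz s hs => ((hu.contDiffOn_space s (hI (Ioc_subset_Icc_self hs))).contDiffAt
      (hΩ.mem_nhds hz.1)).sub (contDiffAt_const.add (hw z (subset_closure hz.2)))
  · exact fun z hz s hs => (hu.differentiableAt_time z hz.1 s (hI (Ioc_subset_Icc_self hs))).sub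
      ((hy s (Ioc_subset_Icc_self hs)).differentiableAt.add_const _)
  · intro z hz s hs hlt
    have hs' := Ioc_subset_Icc_self hs
    have hz' := subset_closure hz.2
    exact hu.deriv_sub_lt_laplacian_sub hΩ hq hz.1 (hI hs') (hpos s hs') (hy₀ s hs') (hy s hs')
      (hw₀ z hz') (hw z hz') (hΔw z hz.2 s hs') (sub_pos.1 hlt)

theorem IsDirichletSubsolution.le_add (hu : IsDirichletSubsolution Ω I h q u) (hΩ : IsOpen Ω)
    (hq : 1 ≤ q) {τ t : ℝ} (hτt : τ < t) (hI : Icc τ t ⊆ I) (hpos : ∀ s ∈ Icc τ t, 0 < h s)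
    {c : ℝ} (hc : ∀ s ∈ Icc τ t, c ≤ h s) {y : ℝ → ℝ} (hy₀ : ∀ s ∈ Ioc τ t, 0 ≤ y s)
    (hy : ∀ s ∈ Ioc τ t, HasDerivAt y (-(h s * y s ^ q)) s) (hyτ : Tendsto y (𝓝[>] τ) atTop)
    {x₀ : E} {R : ℝ} {w : E → ℝ} (hw : IsLargeSupersolution x₀ R c q w)
    {x : E} (hx : x ∈ Ω) (hxR : x ∈ ball x₀ R) : u x t ≤ y t + w x := by
  obtain ⟨M, hM⟩ : BddAbove ((fun p : E × ℝ => u p.1 p.2) ''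
      ((closure Ω ∩ closedBall x₀ R) ×ˢ Icc τ t)) :=
    (((isCompact_closedBall x₀ R).inter_left isClosed_closure).prod isCompact_Icc).bddAbove_image
      (hu.continuousOn.mono (prod_mono inter_subset_left hI))
  have huM : ∀ z ∈ closure Ω, z ∈ ball x₀ R → ∀ s ∈ Icc τ t, u z s ≤ M :=
    fun z hz hzR s hs => hM ⟨(z, s), ⟨⟨hz, ball_subset_closedBall hzR⟩, hs⟩, rfl⟩
  obtain ⟨ρ, hwρ, hxρ, hρR⟩ : ∃ ρ, (∀ z, dist z x₀ = ρ → M ≤ w z) ∧ dist x x₀ < ρ ∧ ρ < R :=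
    ((eventually_comap.1 (hw.tendsto_atTop.eventually_ge_atTop M)).and
      (Ioo_mem_nhdsLT hxR)).exists
  obtain ⟨σ, hyσ, hτσ, hσt⟩ : ∃ σ, M ≤ y σ ∧ τ < σ ∧ σ < t :=
    ((hyτ.eventually_ge_atTop M).and (Ioo_mem_nhdsGT hτt)).exists
  have hσI : Icc σ t ⊆ Ioc τ t := fun s hs => ⟨hτσ.trans_le hs.1, hs.2⟩
  have hσI' : Icc σ t ⊆ Icc τ t := Icc_subset_Icc_left hτσ.le
  have hρ : closure (ball x₀ ρ) ⊆ ball x₀ R :=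
    closure_ball_subset_closedBall.trans (closedBall_subset_ball hρR)
  refine hu.le_add_of_le_on_boundary hΩ hq isOpen_ball isBounded_ball hσt.le (hσI'.trans hI)
    (fun s hs => hpos s (hσI' hs)) (fun s hs => hy₀ s (hσI hs)) (fun s hs => hy s (hσI hs))
    (fun z hz => hw.nonneg z (hρ hz)) (fun z hz => hw.contDiffAt z (hρ hz)) ?_ ?_ ?_ ⟨hx, hxρ⟩
  · intro z hz s hs
    have hzR := hρ (subset_closure hz)
    exact (hw.laplacian_le z hzR).trans
      (mul_le_mul_of_nonneg_right (hc s (hσI' hs)) (Real.rpow_nonneg (hw.nonneg z hzR) q))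
  · exact fun z hz => (huM z hz.1 (hρ hz.2) σ ⟨hτσ.le, hσt.le⟩).trans
      (hyσ.trans (le_add_of_nonneg_right (hw.nonneg z (hρ hz.2))))
  · intro z hz s hs
    have hzR := hρ (frontier_subset_closure hz.2)
    exact (huM z hz.1 hzR s (hσI' hs)).trans
      ((hwρ z (frontier_ball_subset_sphere hz.2)).trans
        (le_add_of_nonneg_left (hy₀ s (hσI hs))))

end Comparison

theorem norm_sub_sq_lt_of_mem_ball {E : Type*} [SeminormedAddCommGroup E] {x₀ x : E} {R : ℝ}
    (hx : x ∈ ball x₀ R) : ‖x - x₀‖ ^ 2 < R ^ 2 :=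
  pow_lt_pow_left₀ (mem_ball_iff_norm.1 hx) (norm_nonneg _) two_ne_zero

section Barriers

variable {E : Type*} [NormedAddCommGroup E] [InnerProductSpace ℝ E]

/-- The constant `K` with `Δ (a - |x - x₀|²)^(-k) ≤ K a (a - |x - x₀|²)^(-k-2)` in dimension `n`,
for the exponent `k = 2 / (q - 1)` of the Keller–Osserman barrier. -/
noncomputable def kellerOssermanConst (n : ℕ) (q : ℝ) : ℝ :=
  4 * (2 / (q - 1)) * (2 / (q - 1) + 1) + 2 * n * (2 / (q - 1))

/-- The Keller–Osserman barrier: a nonnegative supersolution of `-Δw + c w^q = 0` in the ball of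
centre `x₀` and radius `R` which is infinite on the boundary sphere. -/
noncomputable def kellerOsserman (x₀ : E) (R c q : ℝ) (x : E) : ℝ :=
  (kellerOssermanConst (Module.finrank ℝ E) q * R ^ 2 / c) ^ (1 / (q - 1)) *
    (R ^ 2 - ‖x - x₀‖ ^ 2) ^ (-(2 / (q - 1)))

variable {x₀ x : E} {R c q : ℝ}

theorem kellerOssermanConst_pos (n : ℕ) (hq : 1 < q) : 0 < kellerOssermanConst n q := by
  have : 0 < q - 1 := sub_pos.2 hq
  unfold kellerOssermanConst
  positivity

theorem laplacian_rpow_neg_sub_norm_sq_le [FiniteDimensional ℝ E] {a k : ℝ} (hk : 0 ≤ k)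
    (hx : ‖x - x₀‖ ^ 2 < a) :
    Δ (fun y => (a - ‖y - x₀‖ ^ 2) ^ (-k)) x ≤
      (4 * k * (k + 1) + 2 * Module.finrank ℝ E * k) * a * (a - ‖x - x₀‖ ^ 2) ^ (-k - 2) := by
  have hφ : 0 < a - ‖x - x₀‖ ^ 2 := sub_pos.2 hx
  have hpow : (a - ‖x - x₀‖ ^ 2) ^ (-k - 1) =
      (a - ‖x - x₀‖ ^ 2) ^ (-k - 2) * (a - ‖x - x₀‖ ^ 2) := by
    rw [← Real.rpow_add_one hφ.ne']
    ring_nf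
  calc Δ (fun y => (a - ‖y - x₀‖ ^ 2) ^ (-k)) x
      = (4 * k * (k + 1) * ‖x - x₀‖ ^ 2 + 2 * Module.finrank ℝ E * k * (a - ‖x - x₀‖ ^ 2)) *
          (a - ‖x - x₀‖ ^ 2) ^ (-k - 2) := by
        rw [laplacian_rpow_sub_norm_sq hx, hpow]
        ring
    _ ≤ (4 * k * (k + 1) * a + 2 * Module.finrank ℝ E * k * a) *
          (a - ‖x - x₀‖ ^ 2) ^ (-k - 2) := by
        gcongr
        exact sub_le_self a (sq_nonneg _)
    _ = _ := by ring

theorem laplacian_kellerOsserman_le [FiniteDimensional ℝ E] (hc : 0 < c) (hq : 1 < q)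
    (hx : x ∈ ball x₀ R) :
    Δ (kellerOsserman x₀ R c q) x ≤ c * kellerOsserman x₀ R c q x ^ q := by
  have hq₁ : 0 < q - 1 := sub_pos.2 hq
  have hxR : ‖x - x₀‖ ^ 2 < R ^ 2 := norm_sub_sq_lt_of_mem_ball hx
  have hφ : 0 < R ^ 2 - ‖x - x₀‖ ^ 2 := sub_pos.2 hxR
  set k := 2 / (q - 1) with hk
  set K := kellerOssermanConst (Module.finrank ℝ E) q
  have hB : 0 < K * R ^ 2 / c :=
    div_pos (mul_pos (kellerOssermanConst_pos _ hq) ((sq_nonneg _).trans_lt hxR)) hc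
  set A := (K * R ^ 2 / c) ^ (1 / (q - 1)) with hA
  have hAq : c * A ^ q = A * (K * R ^ 2) := by
    have hexp : 1 / (q - 1) * q = 1 / (q - 1) + 1 := by field_simp; ring
    rw [hA, ← Real.rpow_mul hB.le, hexp, Real.rpow_add_one hB.ne']
    field_simp
  have hkq : -k * q = -k - 2 := by rw [hk]; field_simp; ring
  calc Δ (kellerOsserman x₀ R c q) x
      = A * Δ (fun y => (R ^ 2 - ‖y - x₀‖ ^ 2) ^ (-k)) x :=
        InnerProductSpace.laplacian_smul A (contDiffAt_rpow_sub_norm_sq hxR _)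
    _ ≤ A * (K * R ^ 2 * (R ^ 2 - ‖x - x₀‖ ^ 2) ^ (-k - 2)) := by
        have : 0 ≤ k := by positivity
        gcongr
        exact laplacian_rpow_neg_sub_norm_sq_le this hxR
    _ = c * (A * (R ^ 2 - ‖x - x₀‖ ^ 2) ^ (-k)) ^ q := by
        rw [Real.mul_rpow (by positivity) (by positivity), ← Real.rpow_mul hφ.le, hkq,
          ← mul_assoc c, hAq]
        ring

theorem tendsto_kellerOsserman_atTop (hR : 0 < R) (hc : 0 < c) (hq : 1 < q) :
    Tendsto (kellerOsserman x₀ R c q) (comap (fun x => dist x x₀) (𝓝[<] R)) atTop := by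
  have hK := kellerOssermanConst_pos (Module.finrank ℝ E) hq
  have hφ : Tendsto (fun r : ℝ => R ^ 2 - r ^ 2) (𝓝[<] R) (𝓝[>] 0) := by
    refine tendsto_nhdsWithin_iff.2 ⟨?_, ?_⟩
    · have : Tendsto (fun r : ℝ => R ^ 2 - r ^ 2) (𝓝 R) (𝓝 (R ^ 2 - R ^ 2)) :=
        Continuous.tendsto (by fun_prop) R
      rw [sub_self] at this
      exact this.mono_left nhdsWithin_le_nhds
    · filter_upwards [Ioo_mem_nhdsLT hR] with r hr
      exact sub_pos.2 (pow_lt_pow_left₀ hr.2 hr.1.le two_ne_zero)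
  have hpow : Tendsto (fun r : ℝ => (R ^ 2 - r ^ 2) ^ (-(2 / (q - 1)))) (𝓝[<] R) atTop :=
    (tendsto_rpow_neg_nhdsGT_zero (by simpa using hq)).comp hφ
  have hA : 0 < (kellerOssermanConst (Module.finrank ℝ E) q * R ^ 2 / c) ^ (1 / (q - 1)) := by
    positivity
  refine ((hpow.const_mul_atTop hA).comp
    (tendsto_comap (f := fun x => dist x x₀))).congr fun x => ?_
  simp only [Function.comp_apply, kellerOsserman, dist_eq_norm]

theorem isLargeSupersolution_kellerOsserman [FiniteDimensional ℝ E] (hR : 0 < R) (hc : 0 < c)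
    (hq : 1 < q) : IsLargeSupersolution x₀ R c q (kellerOsserman x₀ R c q) where
  nonneg x hx := by
    have hK := kellerOssermanConst_pos (Module.finrank ℝ E) hq
    have := sub_pos.2 (norm_sub_sq_lt_of_mem_ball hx)
    unfold kellerOsserman
    positivity
  contDiffAt x hx :=
    contDiffAt_const.mul (contDiffAt_rpow_sub_norm_sq (norm_sub_sq_lt_of_mem_ball hx) _)
  laplacian_le x hx := laplacian_kellerOsserman_le hc hq hx
  tendsto_atTop := tendsto_kellerOsserman_atTop hR hc hq

theorem kellerOsserman_self (hR : 0 < R) (hc : 0 < c) (hq : 1 < q) (x₀ : E) :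
    kellerOsserman x₀ R c q x₀ =
      (kellerOssermanConst (Module.finrank ℝ E) q / c) ^ (1 / (q - 1)) *
        R ^ (-(2 / (q - 1))) := by
  have hK := kellerOssermanConst_pos (Module.finrank ℝ E) hq
  have hpow : (R ^ 2) ^ (1 / (q - 1)) * (R ^ 2) ^ (-(2 / (q - 1))) = R ^ (-(2 / (q - 1))) := by
    rw [← Real.rpow_natCast, ← Real.rpow_mul hR.le, ← Real.rpow_mul hR.le, ← Real.rpow_add hR]
    push_cast
    ring_nf
  rw [kellerOsserman, sub_self, norm_zero, zero_pow two_ne_zero, sub_zero, mul_div_right_comm,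
    Real.mul_rpow (by positivity) (by positivity), mul_assoc, hpow]

theorem tendsto_kellerOsserman_self_atTop (hc : 0 < c) (hq : 1 < q) (x₀ : E) :
    Tendsto (fun R => kellerOsserman x₀ R c q x₀) atTop (𝓝 0) := by
  have hlim := (tendsto_rpow_neg_atTop (div_pos two_pos (sub_pos.2 hq))).const_mul
    ((kellerOssermanConst (Module.finrank ℝ E) q / c) ^ (1 / (q - 1)))
  rw [mul_zero] at hlim
  refine hlim.congr' ?_
  filter_upwards [eventually_gt_atTop 0] with R hR using (kellerOsserman_self hR hc hq x₀).symm

theorem hasDerivAt_rpow_antiderivative {H : ℝ → ℝ} {h C s : ℝ} (hq : 1 < q) (hs : C < H s)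
    (hH : HasDerivAt H h s) :
    HasDerivAt (fun r => ((q - 1) * (H r - C)) ^ (-(1 / (q - 1))))
      (-(h * (((q - 1) * (H s - C)) ^ (-(1 / (q - 1)))) ^ q)) s := by
  have hq₁ : 0 < q - 1 := sub_pos.2 hq
  have hbase : 0 < (q - 1) * (H s - C) := mul_pos hq₁ (sub_pos.2 hs)
  have hexp : -(1 / (q - 1)) * q = -(1 / (q - 1)) - 1 := by field_simp; ring
  convert! ((hH.sub_const C).const_mul (q - 1)).rpow_const (p := -(1 / (q - 1)))
    (Or.inl hbase.ne') using 1
  rw [← Real.rpow_mul hbase.le, hexp]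
  field_simp

theorem tendsto_rpow_antiderivative_atTop {H : ℝ → ℝ} {τ : ℝ} (hq : 1 < q)
    (hH : ContinuousAt H τ) (hlt : ∀ᶠ s in 𝓝[>] τ, H τ < H s) :
    Tendsto (fun s => ((q - 1) * (H s - H τ)) ^ (-(1 / (q - 1)))) (𝓝[>] τ) atTop := by
  have hq₁ : 0 < q - 1 := sub_pos.2 hq
  refine (tendsto_rpow_neg_nhdsGT_zero (by simpa using hq)).comp
    (tendsto_nhdsWithin_iff.2 ⟨?_, ?_⟩)
  · have : Tendsto (fun s => (q - 1) * (H s - H τ)) (𝓝 τ) (𝓝 ((q - 1) * (H τ - H τ))) :=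
      (hH.sub_const _).const_mul _
    rw [sub_self, mul_zero] at this
    exact this.mono_left nhdsWithin_le_nhds
  · filter_upwards [hlt] with s hs using mul_pos hq₁ (sub_pos.2 hs)

end Barriers

section Bound

variable {E : Type*} [NormedAddCommGroup E] [InnerProductSpace ℝ E] [FiniteDimensional ℝ E]
  {Ω : Set E} {q : ℝ} {u : E → ℝ → ℝ}

theorem IsDirichletSubsolution.le_rpow_of_antiderivative {I : Set ℝ} {h H : ℝ → ℝ}
    (hu : IsDirichletSubsolution Ω I h q u) (hΩ : IsOpen Ω) (hq : 1 < q) {τ t : ℝ} (hτt : τ < t)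
    (hI : Icc τ t ⊆ I) (hcont : ContinuousOn h (Icc τ t)) (hpos : ∀ s ∈ Icc τ t, 0 < h s)
    (hH : ∀ s ∈ Icc τ t, HasDerivAt H (h s) s) {x : E} (hx : x ∈ Ω) :
    u x t ≤ ((q - 1) * (H t - H τ)) ^ (-(1 / (q - 1))) := by
  have hτ : τ ∈ Icc τ t := left_mem_Icc.2 hτt.le
  have hmono : StrictMonoOn H (Icc τ t) :=
    strictMonoOn_of_hasDerivWithinAt_pos (convex_Icc τ t)
      (fun s hs => (hH s hs).continuousAt.continuousWithinAt)
      (fun s hs => (hH s (interior_subset hs)).hasDerivWithinAt)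
      (fun s hs => hpos s (interior_subset hs))
  have hlt : ∀ s ∈ Ioc τ t, H τ < H s :=
    fun s hs => hmono hτ (Ioc_subset_Icc_self hs) hs.1
  obtain ⟨s₀, hs₀, hmin⟩ := isCompact_Icc.exists_isMinOn ⟨τ, hτ⟩ hcont
  have hbound : ∀ R > 0,
      u x t ≤ ((q - 1) * (H t - H τ)) ^ (-(1 / (q - 1))) + kellerOsserman x R (h s₀) q x :=
    fun R hR => hu.le_add hΩ hq.le hτt hI hpos (fun s hs => hmin hs)
      (fun s hs => Real.rpow_nonneg
        (mul_nonneg (sub_nonneg.2 hq.le) (sub_nonneg.2 (hlt s hs).le)) _)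
      (fun s hs => hasDerivAt_rpow_antiderivative hq (hlt s hs) (hH s (Ioc_subset_Icc_self hs)))
      (tendsto_rpow_antiderivative_atTop hq (hH τ hτ).continuousAt
        (mem_of_superset (Ioc_mem_nhdsGT hτt) hlt))
      (isLargeSupersolution_kellerOsserman hR (hpos s₀ hs₀) hq) hx (mem_ball_self hR)
  have hlim := (tendsto_kellerOsserman_self_atTop (hpos s₀ hs₀) hq x).const_add
    (((q - 1) * (H t - H τ)) ^ (-(1 / (q - 1))))
  rw [add_zero] at hlim
  exact ge_of_tendsto hlim ((eventually_gt_atTop 0).mono hbound)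

theorem rpow_neg_mul_rpow_div {a b t : ℝ} (ha : 0 < a) (hb : 0 < b) (ht : 0 ≤ t) :
    (b * (t ^ a / a)) ^ (-(1 / b)) = (a / b) ^ (1 / b) * t ^ (-(a / b)) := by
  have hbase : b * (t ^ a / a) = (a / b)⁻¹ * t ^ a := by field_simp
  rw [hbase, Real.mul_rpow (by positivity) (by positivity), Real.inv_rpow (by positivity),
    Real.rpow_neg (by positivity), inv_inv, ← Real.rpow_mul ht]
  ring_nf

theorem hasDerivAt_rpow_one_add_div {α s : ℝ} (hα : -1 < α) (hs : 0 < s) :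
    HasDerivAt (fun r => r ^ (1 + α) / (1 + α)) (s ^ α) s := by
  have hα₁ : 1 + α ≠ 0 := by linarith
  convert! (Real.hasDerivAt_rpow_const (p := 1 + α) (Or.inl hs.ne')).div_const (1 + α) using 1
  rw [add_sub_cancel_left, mul_div_cancel_left₀ _ hα₁]

theorem proposition4p1_general (hΩ : IsOpen Ω) {T α : ℝ} (hα : -1 < α) (hq : 1 < q)
    (hu : IsDirichletSubsolution Ω (Ioo 0 T) (fun s => s ^ α) q u) {x : E} (hx : x ∈ Ω) {t : ℝ}
    (ht : t ∈ Ioo 0 T) :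
    u x t ≤ ((1 + α) / (q - 1)) ^ (1 / (q - 1)) * t ^ (-((1 + α) / (q - 1))) := by
  have hα₁ : 0 < 1 + α := by linarith
  have hq₁ : 0 < q - 1 := sub_pos.2 hq
  set H : ℝ → ℝ := fun s => s ^ (1 + α) / (1 + α)
  have hbound : ∀ τ ∈ Ioo 0 t, u x t ≤ ((q - 1) * (H t - H τ)) ^ (-(1 / (q - 1))) := by
    intro τ hτ
    have hpos : ∀ s ∈ Icc τ t, 0 < s := fun s hs => hτ.1.trans_le hs.1
    exact hu.le_rpow_of_antiderivative hΩ hq hτ.2 (Icc_subset_Ioo hτ.1 ht.2)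
      (continuousOn_id.rpow_const fun s hs => Or.inl (hpos s hs).ne')
      (fun s hs => Real.rpow_pos_of_pos (hpos s hs) α)
      (fun s hs => hasDerivAt_rpow_one_add_div hα (hpos s hs)) hx
  have hH₀ : Tendsto H (𝓝[>] 0) (𝓝 0) := by
    have hcont : ContinuousAt H 0 :=
      (Real.continuousAt_rpow_const 0 (1 + α) (Or.inr hα₁.le)).div_const (1 + α)
    simpa [H, Real.zero_rpow hα₁.ne'] using hcont.tendsto.mono_left nhdsWithin_le_nhds
  have hbase : 0 < (q - 1) * (H t - 0) := by
    rw [sub_zero]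
    exact mul_pos hq₁ (div_pos (Real.rpow_pos_of_pos ht.1 _) hα₁)
  have hlim := ((hH₀.const_sub (H t)).const_mul (q - 1)).rpow_const (p := -(1 / (q - 1)))
    (Or.inl hbase.ne')
  rw [sub_zero, rpow_neg_mul_rpow_div hα₁ hq₁ ht.1.le] at hlim
  exact ge_of_tendsto hlim (mem_of_superset (Ioo_mem_nhdsGT ht.1) hbound)

end Bound

theorem IsSolution.isDirichletSubsolution {N : ℕ} {Ω : Set (EuclideanSpace ℝ (Fin N))}
    {T α q : ℝ} {u : EuclideanSpace ℝ (Fin N) → ℝ → ℝ} (hu : IsSolution Ω T α q u)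
    (hu₀ : VanishesOnLateralBoundary Ω T u) :
    IsDirichletSubsolution Ω (Ioo 0 T) (fun t => t ^ α) q u where
  contDiffOn_space := hu.isC21.contDiffOn_space
  differentiableAt_time := hu.isC21.differentiableAt_time
  deriv_add_le_laplacian x hx t ht hpos := by
    have hpow : u x t ^ q = |u x t| ^ (q - 1) * u x t := by
      rw [abs_of_pos hpos, ← Real.rpow_add_one hpos.ne', sub_add_cancel]
    rw [hpow]
    linarith [hu.equation x hx t ht]
  continuousOn := hu₀.continuousOn
  nonpos_of_mem_frontier x hx t ht := (hu₀.eq_zero x hx t ht).le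

theorem proposition4p1 {N : ℕ} (Ω : Set (EuclideanSpace ℝ (Fin N))) (hΩ : IsOpen Ω)
    (T α q : ℝ) (hT : 0 < T) (hα : -1 < α) (hq : 1 < q)
    (u : EuclideanSpace ℝ (Fin N) → ℝ → ℝ)
    (hu : IsSolution Ω T α q u) (hu0 : VanishesOnLateralBoundary Ω T u) :
    ∀ x ∈ Ω, ∀ t ∈ Set.Ioo 0 T,
      u x t ≤ ((1 + α) / (q - 1)) ^ (1 / (q - 1)) * t ^ (-((1 + α) / (q - 1))) :=
  fun _ hx _ ht => proposition4p1_general hΩ hα hq (hu.isDirichletSubsolution hu0) hx ht
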